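/- Let $\mathfrak{H}=\mathbb{Q}\langle x,y\rangle$ be the noncommutative polynomial ring in two indeterminates $x,y$, and let $\mathfrak{H}^0=\mathbb{Q}+x\mathfrak{H}y$. Put $z=x+y$ and $z_k=x^{k-1}y$ for $k\ge 1$. For integers $k_1\ge 2$ and $k_2,\dots,k_r\ge 1$ let \[ \zeta(k_1,\dots,k_r)=\sum_{n_1>\cdots>n_r\ge 1}\frac{1}{n_1^{k_1}\cdots n_r^{k_r}}, \] and let $Z\colon\mathfrak{H}^0\to\mathbb{R}$ be the $\mathbb{Q}$-linear map with $Z(1)=1$ and $Z(z_{k_1}\cdots z_{k_r})=\zeta(k_1,\dots,k_r)$ for all such $k_1,\dots,k_r$ ($r\ge 1$). For $l\ge 1$ let $\partial_l\colon\mathfrak{H}\to\mathfrak{H}$ be the unique $\mathbb{Q}$-linear map with $\partial_l(ww')=\partial_l(w)w'+w\,\partial_l(w')$ for all $w,w'\in\mathfrak{H}$, $\partial_l(x)=xz^{l-1}y$ and $\partial_l(y)=-xz^{l-1}y$; it maps $\mathfrak{H}^0$ into itself. Then, for every integer $l\ge 1$ and every $w\in\mathfrak{H}^0$, \[ Z(\partial_l(w))=0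 . \] -/

import Mathlib

noncomputable section

namespace MZV

/-- The two letters of the alphabet. -/
inductive Letter : Type
  | X : Letter
  | Y : Letter

/-- The noncommutative polynomial ring `𝔥 = ℚ⟨x, y⟩`. -/
abbrev H : Type := FreeAlgebra ℚ Letter

/-- The indeterminate `x` of `𝔥`. -/
def x : H := FreeAlgebra.ι ℚ Letter.X

/-- The indeterminate `y` of `𝔥`. -/
def y : H := FreeAlgebra.ι ℚ Letter.Y

/-- `z = x + y`. -/
def z : H := x + y

/-- `𝔥⁰ = ℚ + x 𝔥 y`, as a `ℚ`-subspace of `𝔥`. -/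
def H0 : Submodule ℚ H :=
  Submodule.span ℚ {1} ⊔
    LinearMap.range (LinearMap.mulLeft ℚ x ∘ₗ LinearMap.mulRight ℚ y)

/-- The word `z_k = x^(k-1) y`, used for `k ≥ 1`. -/
def zWord (k : ℕ) : H := x ^ (k - 1) * y

/-- The multiple zeta value
`ζ(k₁, …, k_r) = ∑_{n₁ > ⋯ > n_r ≥ 1} 1 / (n₁^k₁ ⋯ n_r^k_r)`. -/
def zeta (k : List ℕ) : ℝ :=
  ∑' n : {n : Fin k.length → ℕ // StrictAnti n ∧ ∀ i, 1 ≤ n i},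
    ∏ i : Fin k.length, 1 / (n.1 i : ℝ) ^ k.get i

/-- The list `(k₁, …, k_r)` with `w = x^(k₁-1) y ⋯ x^(k_r-1) y`, for a word `w` that is empty or
ends in `y` (for other words the final block of `x`'s is ignored). -/
def wordIndex : List Letter → List ℕ
  | [] => []
  | Letter.Y :: w => 1 :: wordIndex w
  | Letter.X :: w =>
    match wordIndex w with
    | [] => []
    | k :: ks => (k + 1) :: ks

/-- The `ℚ`-linear map `Z : 𝔥⁰ → ℝ` with `Z(1) = 1` and `Z(z_{k₁} ⋯ z_{k_r}) = ζ(k₁, …, k_r)`: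
the restriction to `𝔥⁰` of the linear map given on the basis of words through `wordIndex`;
see `Z_one` and `Z_zWord`. -/
def Z : H0 →ₗ[ℚ] ℝ :=
  ((FreeAlgebra.basisFreeMonoid ℚ Letter).constr ℚ
    (fun w : FreeMonoid Letter => zeta (wordIndex (FreeMonoid.toList w)))) ∘ₗ H0.subtype

/-- The images of the letters under `∂_l`: `x ↦ x z^(l-1) y` and `y ↦ - x z^(l-1) y`. -/
def partialLetter (l : ℕ) : Letter → H
  | Letter.X => x * z ^ (l - 1) * y
  | Letter.Y => -(x * z ^ (l - 1) * y)

/-- The algebra map `w ↦ (w, ∂_l(w))` into the square-zero extension of `𝔥` by itself. -/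
def partialLift (l : ℕ) : H →ₐ[ℚ] TrivSqZeroExt H H :=
  FreeAlgebra.lift ℚ fun a =>
    TrivSqZeroExt.inl (FreeAlgebra.ι ℚ a) + TrivSqZeroExt.inr (partialLetter l a)

/-- The derivation `∂_l` of `𝔥` with `∂_l(x) = x z^(l-1) y` and `∂_l(y) = - x z^(l-1) y`, for
`l ≥ 1`; see `partialD_mul`, `partialD_x`, `partialD_y` and `partialD_unique`. -/
def partialD (l : ℕ) : H →ₗ[ℚ] H :=
  TrivSqZeroExt.sndHom H H |>.restrictScalars ℚ |>.comp (partialLift l).toLinearMap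

theorem partialLift_fst (l : ℕ) (w : H) : (partialLift l w).fst = w := by
  have h : (TrivSqZeroExt.fstHom ℚ H H).comp (partialLift l) = AlgHom.id ℚ H := by
    apply FreeAlgebra.hom_ext
    funext a
    simp [partialLift]
  exact DFunLike.congr_fun h w

theorem partialD_apply (l : ℕ) (w : H) : partialD l w = (partialLift l w).snd := rfl

theorem partialD_x (l : ℕ) : partialD l x = x * z ^ (l - 1) * y := by
  simp [partialD_apply, partialLift, x, partialLetter]

theorem partialD_y (l : ℕ) : partialD l y = -(x * z ^ (l - 1) * y) := by
  simp [partialD_apply, partialLift, y, partialLetter]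

/-- Leibniz's rule. -/
theorem partialD_mul (l : ℕ) (v w : H) :
    partialD l (v * w) = partialD l v * w + v * partialD l w := by
  simp [partialD_apply, partialLift_fst, add_comm]

theorem partialD_one (l : ℕ) : partialD l 1 = 0 := by
  simp [partialD_apply]

/-- A derivation of `𝔥` is determined by its values at `x` and `y`. -/
theorem partialD_unique (l : ℕ) (d : H →ₗ[ℚ] H)
    (hmul : ∀ v w, d (v * w) = d v * w + v * d w)
    (hx : d x = x * z ^ (l - 1) * y) (hy : d y = -(x * z ^ (l - 1) * y)) :
    d = partialD l := by
  have h1 : d 1 = 0 := by simpa using hmul 1 1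
  ext w
  induction w using FreeAlgebra.induction with
  | grade0 r =>
    rw [Algebra.algebraMap_eq_smul_one, map_smul, map_smul, h1, partialD_one]
  | grade1 a =>
    cases a with
    | X => exact hx.trans (partialD_x l).symm
    | Y => exact hy.trans (partialD_y l).symm
  | mul a b ha hb => rw [hmul, partialD_mul, ha, hb]
  | add a b ha hb => rw [map_add, map_add, ha, hb]

theorem mem_H0_iff (w : H) : w ∈ H0 ↔ ∃ (q : ℚ) (v : H), w = algebraMap ℚ H q + x * v * y := by
  simp only [H0, Submodule.mem_sup, Submodule.mem_span_singleton, LinearMap.mem_range]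
  constructor
  · rintro ⟨_, ⟨q, rfl⟩, _, ⟨v, rfl⟩, rfl⟩
    exact ⟨q, v, by simp [Algebra.algebraMap_eq_smul_one, mul_assoc]⟩
  · rintro ⟨q, v, rfl⟩
    exact ⟨_, ⟨q, rfl⟩, _, ⟨v, rfl⟩, by simp [Algebra.algebraMap_eq_smul_one, mul_assoc]⟩

/-- `∂_l` maps `𝔥⁰` into itself. -/
theorem partialD_mem_H0 (l : ℕ) {w : H} (hw : w ∈ H0) : partialD l w ∈ H0 := by
  obtain ⟨q, v, rfl⟩ := (mem_H0_iff w).1 hw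
  refine (mem_H0_iff _).2
    ⟨0, z ^ (l - 1) * y * v + partialD l v - v * x * z ^ (l - 1), ?_⟩
  rw [map_add, Algebra.algebraMap_eq_smul_one, map_smul, partialD_one, partialD_mul, partialD_mul,
    partialD_x, partialD_y]
  simp only [map_zero, smul_zero]
  noncomm_ring

theorem one_mem_H0 : (1 : H) ∈ H0 := (mem_H0_iff 1).2 ⟨1, 0, by simp⟩

theorem zWord_prod_mem_H0 (k : ℕ) (ks : List ℕ) (hk : 2 ≤ k) :
    ((k :: ks).map zWord).prod ∈ H0 := by
  have hlast : ∀ (v : H) (ks : List ℕ), ∃ u : H, v * y * (ks.map zWord).prod = u * y := by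
    intro v ks
    induction ks generalizing v with
    | nil => exact ⟨v, by simp⟩
    | cons m ms ih =>
      obtain ⟨u, hu⟩ := ih (v * y * x ^ (m - 1))
      exact ⟨u, by rw [← hu]; simp [zWord, mul_assoc]⟩
  obtain ⟨j, rfl⟩ : ∃ j, k = j + 2 := ⟨k - 2, by omega⟩
  obtain ⟨u, hu⟩ := hlast (x ^ j) ks
  refine (mem_H0_iff _).2 ⟨0, u, ?_⟩
  rw [mul_assoc, ← hu]
  simp [zWord, pow_succ', mul_assoc]

/-- The word `z_{k₁} ⋯ z_{k_r}` as a list of letters. -/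
def indexWord : List ℕ → List Letter
  | [] => []
  | k :: ks => List.replicate (k - 1) Letter.X ++ Letter.Y :: indexWord ks

theorem wordIndex_indexWord (ks : List ℕ) (hks : ∀ k ∈ ks, 1 ≤ k) :
    wordIndex (indexWord ks) = ks := by
  have hrep : ∀ (j : ℕ) (w : List Letter),
      wordIndex (List.replicate j Letter.X ++ Letter.Y :: w) = (j + 1) :: wordIndex w := by
    intro j w
    induction j with
    | zero => simp [wordIndex]
    | succ j ih => simp [List.replicate_succ, wordIndex, ih]
  induction ks with
  | nil => rfl
  | cons k ks ih =>
    rw [indexWord, hrep, ih fun m hm => hks m (List.mem_cons_of_mem _ hm)]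
    have := hks k List.mem_cons_self
    congr 1
    omega

theorem basis_indexWord (ks : List ℕ) :
    FreeAlgebra.basisFreeMonoid ℚ Letter (FreeMonoid.ofList (indexWord ks)) =
      (ks.map zWord).prod := by
  have hb : ∀ w : FreeMonoid Letter, FreeAlgebra.basisFreeMonoid ℚ Letter w =
      FreeMonoid.lift (FreeAlgebra.ι ℚ) w := by
    intro w
    simp [FreeAlgebra.basisFreeMonoid, FreeAlgebra.equivMonoidAlgebraFreeMonoid]
  rw [hb]
  induction ks with
  | nil => simp [indexWord]
  | cons k ks ih =>
    rw [indexWord, FreeMonoid.ofList_append, FreeMonoid.ofList_cons, map_mul, map_mul, ih]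
    simp [zWord, x, y, FreeMonoid.lift_apply, mul_assoc]

theorem Z_one : Z ⟨1, one_mem_H0⟩ = 1 := by
  have h := basis_indexWord []
  simp only [List.map_nil, List.prod_nil] at h
  simp only [Z, LinearMap.comp_apply, Submodule.subtype_apply]
  rw [← h, Module.Basis.constr_basis]
  let u : Unique {n : Fin ([] : List ℕ).length → ℕ // StrictAnti n ∧ ∀ i, 1 ≤ n i} :=
    { default := ⟨Fin.elim0, fun i => i.elim0, fun i => i.elim0⟩
      uniq := fun n => Subtype.ext (funext fun i => i.elim0) }
  change zeta [] = 1
  rw [zeta, tsum_eq_single u.default fun n hn => (hn (u.uniq n)).elim]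
  exact Finset.prod_eq_one fun i => i.elim0

theorem Z_zWord (k : ℕ) (ks : List ℕ) (hk : 2 ≤ k) (hks : ∀ m ∈ ks, 1 ≤ m) :
    Z ⟨((k :: ks).map zWord).prod, zWord_prod_mem_H0 k ks hk⟩ = zeta (k :: ks) := by
  simp only [Z, LinearMap.comp_apply, Submodule.subtype_apply]
  rw [← basis_indexWord, Module.Basis.constr_basis, FreeMonoid.toList_ofList,
    wordIndex_indexWord]
  intro m hm
  rcases List.mem_cons.1 hm with rfl | hm
  · omega
  · exact hks m hm

end MZV

end

/-! Let σ be the homomorphism `shiftHom`, x ↦ x and y ↦ (1 - xt)⁻¹y with t a central formal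
variable. The theorem is deduced from Ohno's relation `ZExt_shiftCoeff_dual`: the coefficients of
Z(σ(w)) do not change when w is replaced by its image under the anti-automorphism exchanging x and
y.

Algebraic part: duality interchanges the derivations `derX j` and `derY j`, and the identities ∑ tʲ
σ(derY (j+1) w) = (d/dt) σ(w) (`shiftHom_derY_series`) and ∑ tⁱ ∂_{i+1}(σ(w)) + ∑ tʲ σ(derY (j+1) w)
= ∑ tʲ σ(derX (j+1) w) (`partialD_shiftHom_series`) hold. When Z is applied to the second, Ohno's
relation and the first turn the right side into (d/dt) Z(σ(w)), which cancels the `derY` sum. Hence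
∑ tⁱ Z(∂_{i+1}(σ(w))) = 0. As σ is the identity at t = 0, induction on the power of t isolates each
Z(∂_{n+1}(w)).

Analytic part: since 1/(m - t) = ∑ tⁱ/mⁱ⁺¹, the series Z(σ(w)) is the nested sum in which y
contributes 1/(m - t) instead of 1/m. Duality of these sums for real t (`tsum_wordSum_dualWord`) is
proved with connected sums: a connector couples two nested sums and lets letters pass from one word
to the other. Comparing power series coefficients in t gives Ohno's relation. -/

noncomputable section

namespace MZV

open PowerSeries Finset

/-! ### Formal sums, geometric series and differentiation over a noncommutative ring. -/

section PowerSeriesSums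

variable {R : Type*} [Ring R]

/-- The formal sum `∑ j, X ^ j * g j` of a sequence of power series. -/
def seriesSum (g : ℕ → R⟦X⟧) : R⟦X⟧ :=
  PowerSeries.mk fun n => coeff n (∑ j ∈ range (n + 1), X ^ j * g j)

theorem coeff_seriesSum (g : ℕ → R⟦X⟧) (n : ℕ) :
    coeff n (seriesSum g) = ∑ j ∈ range (n + 1), coeff (n - j) (g j) := by
  rw [seriesSum, coeff_mk, map_sum]
  refine sum_congr rfl fun j hj => ?_
  rw [coeff_X_pow_mul', if_pos (by simpa [Nat.lt_succ_iff] using hj)]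

/-- Terms with j > n do not reach degree n, so any long enough finite sum may replace the formal
one; this reduces products to finite sums. -/
theorem coeff_seriesSum_of_lt (g : ℕ → R⟦X⟧) {n N : ℕ} (h : n < N) :
    coeff n (seriesSum g) = coeff n (∑ j ∈ range N, X ^ j * g j) := by
  rw [seriesSum, coeff_mk, map_sum, map_sum]
  refine sum_subset (range_subset_range.2 h) fun j _ hj => ?_
  rw [coeff_X_pow_mul', if_neg (by simpa [Nat.lt_succ_iff] using hj)]

theorem seriesSum_add (f g : ℕ → R⟦X⟧) :
    seriesSum (fun j => f j + g j) = seriesSum f + seriesSum g := by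
  ext n
  simp [coeff_seriesSum, sum_add_distrib]

theorem seriesSum_mul_left (p : R⟦X⟧) (g : ℕ → R⟦X⟧) :
    seriesSum (fun j => p * g j) = p * seriesSum g := by
  ext n
  have h : coeff n (p * seriesSum g) = coeff n (p * ∑ j ∈ range (n + 1), X ^ j * g j) := by
    rw [coeff_mul, coeff_mul]
    refine sum_congr rfl fun a ha => ?_
    rw [coeff_seriesSum_of_lt g (N := n + 1) (by have := mem_antidiagonal.1 ha; omega)]
  rw [h, seriesSum, coeff_mk, mul_sum]
  refine congrArg _ (sum_congr rfl fun j _ => ?_)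
  rw [← mul_assoc, ← mul_assoc, ((commute_X p).pow_right j).eq]

theorem seriesSum_mul_right (p : R⟦X⟧) (g : ℕ → R⟦X⟧) :
    seriesSum (fun j => g j * p) = seriesSum g * p := by
  ext n
  have h : coeff n (seriesSum g * p) = coeff n ((∑ j ∈ range (n + 1), X ^ j * g j) * p) := by
    rw [coeff_mul, coeff_mul]
    refine sum_congr rfl fun a ha => ?_
    rw [coeff_seriesSum_of_lt g (N := n + 1) (by have := mem_antidiagonal.1 ha; omega)]
  rw [h, seriesSum, coeff_mk, sum_mul]
  simp only [mul_assoc]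

theorem seriesSum_succ (g : ℕ → R⟦X⟧) :
    seriesSum g = g 0 + X * seriesSum fun j => g (j + 1) := by
  ext n
  cases n with
  | zero => simp [coeff_seriesSum]
  | succ n =>
    rw [map_add, coeff_succ_X_mul, coeff_seriesSum, coeff_seriesSum, sum_range_succ']
    simp [add_comm]

theorem seriesSum_zero : seriesSum (fun _ => (0 : R⟦X⟧)) = 0 := by
  ext n
  simp [coeff_seriesSum]

/-- The geometric series `∑ j, X ^ j * p ^ j`. -/
def geom (p : R⟦X⟧) : R⟦X⟧ := seriesSum fun j => p ^ j

theorem geom_mul_self (p : R⟦X⟧) : geom p * p = p * geom p := by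
  rw [geom, ← seriesSum_mul_left, ← seriesSum_mul_right]
  simp only [← pow_succ, ← pow_succ']

theorem one_sub_mul_geom (p : R⟦X⟧) : (1 - X * p) * geom p = 1 := by
  have h : geom p = 1 + X * (p * geom p) := by
    conv_lhs => rw [geom, seriesSum_succ]
    simp only [geom, pow_succ', pow_zero, seriesSum_mul_left]
  rw [sub_mul, one_mul, mul_assoc]
  nth_rewrite 1 [h]
  abel

theorem geom_mul_one_sub (p : R⟦X⟧) : geom p * (1 - X * p) = 1 := by
  refine Eq.trans ?_ (one_sub_mul_geom p)
  rw [mul_sub, sub_mul, mul_one, one_mul, mul_assoc, ← geom_mul_self, ← mul_assoc,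
    (commute_X (geom p)).eq, mul_assoc]

/-- Formal differentiation with respect to the central variable. -/
def formalDeriv (f : R⟦X⟧) : R⟦X⟧ := PowerSeries.mk fun n => (n + 1) • coeff (n + 1) f

theorem formalDeriv_add (f g : R⟦X⟧) : formalDeriv (f + g) = formalDeriv f + formalDeriv g := by
  ext n
  simp [formalDeriv]

theorem formalDeriv_C (a : R) : formalDeriv (C a) = 0 := by
  ext n
  simp [formalDeriv]

theorem formalDeriv_X_mul (f : R⟦X⟧) : formalDeriv (X * f) = f + X * formalDeriv f := by
  ext n
  cases n with
  | zero => simp [formalDeriv]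
  | succ n =>
    simp only [formalDeriv, coeff_mk, coeff_succ_X_mul, map_add]
    rw [succ_nsmul']

theorem formalDeriv_mul (f g : R⟦X⟧) :
    formalDeriv (f * g) = formalDeriv f * g + f * formalDeriv g := by
  ext n
  have h : (n + 1) • coeff (n + 1) (f * g) =
      ∑ p ∈ antidiagonal (n + 1), p.1 • (coeff p.1 f * coeff p.2 g) +
      ∑ p ∈ antidiagonal (n + 1), p.2 • (coeff p.1 f * coeff p.2 g) := by
    rw [coeff_mul, smul_sum, ← sum_add_distrib]
    refine sum_congr rfl fun p hp => ?_
    rw [← add_smul, mem_antidiagonal.1 hp]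
  rw [map_add, coeff_mul, coeff_mul, formalDeriv, coeff_mk, h, Nat.sum_antidiagonal_succ,
    Nat.sum_antidiagonal_succ']
  simp only [zero_smul, zero_add, formalDeriv, coeff_mk, smul_mul_assoc,
    mul_smul_comm]

end PowerSeriesSums

/-! ### Identities between the derivations and the homomorphism σ. -/

section Derivations

/-- The derivation of `𝔥` with prescribed values at the letters. -/
def letterDer (f : Letter → H) : H →ₗ[ℚ] H :=
  TrivSqZeroExt.sndHom H H |>.restrictScalars ℚ |>.comp
    (FreeAlgebra.lift ℚ fun a =>
      (TrivSqZeroExt.inl (FreeAlgebra.ι ℚ a) + TrivSqZeroExt.inr (f a) :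
        TrivSqZeroExt H H)).toLinearMap

theorem letterDer_ι (f : Letter → H) (a : Letter) : letterDer f (FreeAlgebra.ι ℚ a) = f a := by
  simp [letterDer]

theorem letterDer_mul (f : Letter → H) (v w : H) :
    letterDer f (v * w) = letterDer f v * w + v * letterDer f w := by
  have h : (TrivSqZeroExt.fstHom ℚ H H).comp (FreeAlgebra.lift ℚ fun a =>
      (TrivSqZeroExt.inl (FreeAlgebra.ι ℚ a) + TrivSqZeroExt.inr (f a) :
        TrivSqZeroExt H H)) = AlgHom.id ℚ H := by
    apply FreeAlgebra.hom_ext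
    funext a
    simp
  have h' (w : H) := DFunLike.congr_fun h w
  simp only [AlgHom.comp_apply, TrivSqZeroExt.fstHom_apply, AlgHom.id_apply] at h'
  simp only [letterDer, LinearMap.comp_apply, AlgHom.toLinearMap_apply, map_mul,
    LinearMap.restrictScalars_apply, TrivSqZeroExt.sndHom_apply, TrivSqZeroExt.snd_mul, h']
  rw [add_comm]
  rfl

/-- Two additive maps that satisfy the Leibniz rule along the same ring homomorphism agree as soon as
they agree at the letters. -/
theorem leibniz_ext {A : Type*} [Ring A] [Algebra ℚ A] (s : H → A) (hs : s 1 = 1) (M N : H → A)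
    (hMa : ∀ u v, M (u + v) = M u + M v) (hM : ∀ u v, M (u * v) = M u * s v + s u * M v)
    (hNa : ∀ u v, N (u + v) = N u + N v) (hN : ∀ u v, N (u * v) = N u * s v + s u * N v)
    (hx : M x = N x) (hy : M y = N y) (w : H) : M w = N w := by
  have key (P : H → A) (hPa : ∀ u v, P (u + v) = P u + P v)
      (hP : ∀ u v, P (u * v) = P u * s v + s u * P v) (r : ℚ) : P (algebraMap ℚ H r) = 0 := by
    have h1 : P 1 = 0 := by
      have h := hP 1 1
      rw [hs] at h
      simpa using h
    have h := map_rat_smul (AddMonoidHom.mk' P hPa) r 1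
    simpa [Algebra.algebraMap_eq_smul_one, h1] using h
  induction w using FreeAlgebra.induction with
  | grade0 r => rw [key M hMa hM, key N hNa hN]
  | grade1 a =>
    cases a with
    | X => exact hx
    | Y => exact hy
  | mul a b ha hb => rw [hM, hN, ha, hb]
  | add a b ha hb => rw [hMa, hNa, ha, hb]

/-- The coefficientwise action of a linear endomorphism of `𝔥` on power series. -/
def coeffwise (d : H →ₗ[ℚ] H) (f : H⟦X⟧) : H⟦X⟧ := PowerSeries.mk fun n => d (coeff n f)

theorem coeffwise_add (d : H →ₗ[ℚ] H) (f g : H⟦X⟧) :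
    coeffwise d (f + g) = coeffwise d f + coeffwise d g := by
  ext n
  simp [coeffwise]

theorem coeffwise_mul {d : H →ₗ[ℚ] H} (hd : ∀ u v, d (u * v) = d u * v + u * d v) (f g : H⟦X⟧) :
    coeffwise d (f * g) = coeffwise d f * g + f * coeffwise d g := by
  ext n
  simp [coeffwise, coeff_mul, hd, sum_add_distrib]

theorem coeffwise_X_mul (d : H →ₗ[ℚ] H) (f : H⟦X⟧) :
    coeffwise d (X * f) = X * coeffwise d f := by
  ext n
  cases n <;> simp [coeffwise, coeff_succ_X_mul]

theorem coeffwise_C (d : H →ₗ[ℚ] H) (a : H) : coeffwise d (C a) = C (d a) := by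
  ext n
  simp only [coeffwise, coeff_mk, coeff_C]
  split <;> simp

/-- The homomorphism `x ↦ x`, `y ↦ (1 - x t)⁻¹ y` into power series in a central variable `t`. -/
def shiftHom : H →ₐ[ℚ] H⟦X⟧ :=
  FreeAlgebra.lift ℚ fun
    | Letter.X => C x
    | Letter.Y => PowerSeries.mk fun n => x ^ n * y

theorem shiftHom_x : shiftHom x = C x := by simp [shiftHom, x]

theorem shiftHom_y : shiftHom y = PowerSeries.mk fun n => x ^ n * y := by simp [shiftHom, y]

theorem one_sub_mul_shiftHom_y : (1 - X * C x) * shiftHom y = C y := by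
  ext n
  cases n with
  | zero => simp [shiftHom_y, sub_mul, mul_assoc]
  | succ n =>
    simp only [shiftHom_y, sub_mul, mul_assoc, map_sub, coeff_succ_X_mul, coeff_C_mul, one_mul,
      coeff_mk, coeff_C, pow_succ']
    simp

/-- The coefficient of `t ^ n` in `shiftHom`. -/
def shiftCoeff (n : ℕ) : H →ₗ[ℚ] H :=
  ((PowerSeries.coeff (R := H) n).restrictScalars ℚ).comp shiftHom.toLinearMap

theorem shiftCoeff_apply (n : ℕ) (w : H) : shiftCoeff n w = coeff n (shiftHom w) := rfl

/-- The derivation `x ↦ 0`, `y ↦ x ^ n y`. -/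
def derY (n : ℕ) : H →ₗ[ℚ] H :=
  letterDer fun
    | Letter.X => 0
    | Letter.Y => x ^ n * y

/-- The derivation `x ↦ x y ^ n`, `y ↦ 0`. -/
def derX (n : ℕ) : H →ₗ[ℚ] H :=
  letterDer fun
    | Letter.X => x * y ^ n
    | Letter.Y => 0

theorem derY_x (n : ℕ) : derY n x = 0 := letterDer_ι _ _
theorem derY_y (n : ℕ) : derY n y = x ^ n * y := letterDer_ι _ _
theorem derX_x (n : ℕ) : derX n x = x * y ^ n := letterDer_ι _ _
theorem derX_y (n : ℕ) : derX n y = 0 := letterDer_ι _ _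

theorem derY_mul (n : ℕ) (v w : H) : derY n (v * w) = derY n v * w + v * derY n w :=
  letterDer_mul _ v w

theorem derX_mul (n : ℕ) (v w : H) : derX n (v * w) = derX n v * w + v * derX n w :=
  letterDer_mul _ v w

/-- Both sides obey the Leibniz rule along σ, so only the letters matter. With s = σ(y),
differentiating s = y + txs gives (1 - tx)s' = xs, while the left side at y is (1 - tx)⁻¹xs. -/
theorem shiftHom_derY_series (w : H) :
    seriesSum (fun j => shiftHom (derY (j + 1) w)) = formalDeriv (shiftHom w) := by
  refine leibniz_ext shiftHom (map_one _)
    (fun w => seriesSum (fun j => shiftHom (derY (j + 1) w))) (fun w => formalDeriv (shiftHom w))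
    ?_ ?_ ?_ ?_ ?_ ?_ w
  · intro u v
    simp only [map_add, seriesSum_add]
  · intro u v
    simp only [derY_mul, map_add, map_mul, seriesSum_add, seriesSum_mul_left, seriesSum_mul_right]
  · intro u v
    rw [map_add, formalDeriv_add]
  · intro u v
    rw [map_mul, formalDeriv_mul]
  · simp only [derY_x, map_zero, seriesSum_zero, shiftHom_x, formalDeriv_C]
  · have h : formalDeriv (shiftHom y) =
        C x * shiftHom y + X * (C x * formalDeriv (shiftHom y)) := by
      have h1 : shiftHom y = C y + X * (C x * shiftHom y) := by
        rw [← one_sub_mul_shiftHom_y]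
        noncomm_ring
      conv_lhs => rw [h1]
      rw [formalDeriv_add, formalDeriv_X_mul, formalDeriv_mul, formalDeriv_C, formalDeriv_C]
      simp
    have h2 : (1 - X * C x) * formalDeriv (shiftHom y) = C x * shiftHom y := by
      rw [sub_mul, one_mul, mul_assoc, sub_eq_iff_eq_add]
      exact h
    simp only [derY_y, map_mul, map_pow, shiftHom_x, pow_succ, seriesSum_mul_right]
    change geom (C x) * C x * shiftHom y = _
    rw [mul_assoc, ← h2, ← mul_assoc, geom_mul_one_sub, one_mul]

theorem partialD_series_mul (f g : H⟦X⟧) :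
    seriesSum (fun i => coeffwise (partialD (i + 1)) (f * g)) =
      seriesSum (fun i => coeffwise (partialD (i + 1)) f) * g +
        f * seriesSum (fun i => coeffwise (partialD (i + 1)) g) := by
  simp only [coeffwise_mul (partialD_mul _), seriesSum_add, seriesSum_mul_left,
    seriesSum_mul_right]

/-- Since (1 - tx)σ(y) = y, the product (1 - tx)(1 - tσ(y)) is 1 - tz. This links the powers of z in
∂_l to the powers of y in `derX`. -/
theorem geom_C_z : geom (C z) * (1 - X * C x) = geom (shiftHom y) := by
  have h : geom (C z) * (1 - X * C x) * (1 - X * shiftHom y) = 1 := by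
    have h1 : (1 - X * C x) * (1 - X * shiftHom y) = 1 - X * C z := by
      rw [mul_sub, ← mul_assoc, ((commute_X (1 - X * C x)).eq), mul_assoc,
        one_sub_mul_shiftHom_y, z, map_add]
      noncomm_ring
    rw [mul_assoc, h1, geom_mul_one_sub]
  calc geom (C z) * (1 - X * C x)
      = geom (C z) * (1 - X * C x) * ((1 - X * shiftHom y) * geom (shiftHom y)) := by
        rw [one_sub_mul_geom, mul_one]
    _ = geom (shiftHom y) := by rw [← mul_assoc, h, one_mul]

theorem geom_shiftHom_y_mul : geom (shiftHom y) * shiftHom y = geom (C z) * C y := by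
  rw [← geom_C_z, mul_assoc, one_sub_mul_shiftHom_y]

/-- Again both sides obey the Leibniz rule along σ. At x the claim is x(1 - tz)⁻¹y = x(1 -
tσ(y))⁻¹σ(y); at y the two sums on the left must cancel. -/
theorem partialD_shiftHom_series (w : H) :
    seriesSum (fun i => coeffwise (partialD (i + 1)) (shiftHom w)) +
      seriesSum (fun j => shiftHom (derY (j + 1) w)) =
    seriesSum (fun j => shiftHom (derX (j + 1) w)) := by
  have hq : seriesSum (fun i => coeffwise (partialD (i + 1)) (C x)) =
      C x * geom (shiftHom y) * shiftHom y := by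
    simp only [coeffwise_C, partialD_x, Nat.add_sub_cancel, map_mul, map_pow, seriesSum_mul_left,
      seriesSum_mul_right]
    rw [mul_assoc, mul_assoc, geom_shiftHom_y_mul, geom]
  have hqy : seriesSum (fun i => coeffwise (partialD (i + 1)) (C y)) =
      -(C x * geom (shiftHom y) * shiftHom y) := by
    rw [← hq, eq_neg_iff_add_eq_zero, ← seriesSum_add, ← seriesSum_zero]
    congr 1
    funext i
    rw [coeffwise_C, coeffwise_C, partialD_x, partialD_y, ← map_add, neg_add_cancel, map_zero]
  refine leibniz_ext shiftHom (map_one _)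
    (fun w => seriesSum (fun i => coeffwise (partialD (i + 1)) (shiftHom w)) +
      seriesSum (fun j => shiftHom (derY (j + 1) w)))
    (fun w => seriesSum (fun j => shiftHom (derX (j + 1) w))) ?_ ?_ ?_ ?_ ?_ ?_ w
  · intro u v
    simp only [map_add, coeffwise_add, seriesSum_add]
    abel
  · intro u v
    simp only [derY_mul, map_add, map_mul, partialD_series_mul, seriesSum_add,
      seriesSum_mul_left, seriesSum_mul_right]
    noncomm_ring
  · intro u v
    simp only [map_add, seriesSum_add]
  · intro u v
    simp only [derX_mul, map_add, map_mul, seriesSum_add, seriesSum_mul_left, seriesSum_mul_right]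
  · simp only [derY_x, derX_x, map_zero, seriesSum_zero, add_zero, shiftHom_x, hq, map_mul,
      map_pow, seriesSum_mul_left, pow_succ, seriesSum_mul_right, mul_assoc, geom]
  · simp only [derX_y, derY_y, map_zero, seriesSum_zero, map_mul, map_pow, shiftHom_x, pow_succ,
      seriesSum_mul_right]
    change _ + geom (C x) * C x * shiftHom y = 0
    set T := seriesSum (fun i => coeffwise (partialD (i + 1)) (shiftHom y)) with hT
    have h1 : shiftHom y = C y + X * (C x * shiftHom y) := by
      rw [← one_sub_mul_shiftHom_y]
      noncomm_ring
    -- With D = ∑ tⁱ∂_{i+1}, s = σ(y) and g = (1 - ts)⁻¹, this is D applied to s = y + txs, using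
    -- D(x) = xgs = -D(y). Collecting terms leaves -xg(1 - ts)s = -xs.
    have h2 : T = -(C x * geom (shiftHom y) * shiftHom y) +
        X * (C x * geom (shiftHom y) * shiftHom y * shiftHom y + C x * T) := by
      conv_lhs => rw [hT, h1]
      simp only [coeffwise_add, coeffwise_X_mul, seriesSum_add, seriesSum_mul_left]
      rw [partialD_series_mul, hq, hqy]
    have h3 : (1 - X * C x) * T = -(C x * shiftHom y) := by
      have h4 : (1 - X * C x) * T = -(C x * geom (shiftHom y) * (1 - X * shiftHom y)) *
          shiftHom y := by
        rw [sub_mul, one_mul, sub_eq_iff_eq_add]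
        conv_lhs => rw [h2]
        rw [mul_sub, ← mul_assoc _ X, (commute_X (C x * geom (shiftHom y))).eq]
        noncomm_ring
      rw [h4, mul_assoc, geom_mul_one_sub, mul_one, neg_mul]
    rw [mul_assoc, ← neg_neg (C x * shiftHom y), ← h3, mul_neg, ← mul_assoc, geom_mul_one_sub,
      one_mul, add_neg_cancel]

theorem sum_shiftCoeff_derY (n : ℕ) (w : H) :
    ∑ j ∈ range (n + 1), shiftCoeff (n - j) (derY (j + 1) w) = (n + 1) • shiftCoeff (n + 1) w := by
  have h := congrArg (coeff n) (shiftHom_derY_series w)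
  rw [coeff_seriesSum, formalDeriv, coeff_mk] at h
  exact h

theorem sum_partialD_shiftCoeff (n : ℕ) (w : H) :
    ∑ i ∈ range (n + 1), partialD (i + 1) (shiftCoeff (n - i) w) +
      ∑ j ∈ range (n + 1), shiftCoeff (n - j) (derY (j + 1) w) =
    ∑ j ∈ range (n + 1), shiftCoeff (n - j) (derX (j + 1) w) := by
  have h := congrArg (coeff n) (partialD_shiftHom_series w)
  simp only [map_add, coeff_seriesSum, coeffwise, coeff_mk] at h
  exact h

theorem shiftCoeff_zero_apply (w : H) : shiftCoeff 0 w = w := by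
  rw [shiftCoeff_apply, coeff_zero_eq_constantCoeff_apply]
  induction w using FreeAlgebra.induction with
  | grade0 r =>
    rw [AlgHom.commutes, PowerSeries.algebraMap_apply, PowerSeries.constantCoeff_C]
  | grade1 a =>
    cases a with
    | X =>
      change PowerSeries.constantCoeff (shiftHom x) = x
      rw [shiftHom_x, PowerSeries.constantCoeff_C]
    | Y =>
      change PowerSeries.constantCoeff (shiftHom y) = y
      rw [shiftHom_y, ← coeff_zero_eq_constantCoeff_apply, coeff_mk, pow_zero, one_mul]
  | mul a b ha hb => rw [map_mul, map_mul, ha, hb]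
  | add a b ha hb => rw [map_add, map_add, ha, hb]

end Derivations

end MZV

end

noncomputable section

namespace MZV

/-! ### Deformed nested sums, their convergence and their duality. -/

open Finset Filter Topology

/-- The truncated nested sums attached to a word: `wordSum t w m` collects the terms whose largest
summation index is `m`, where `x` contributes `1 / m` and `y` contributes `1 / (m - t)`. -/
def wordSum (t : ℝ) : List Letter → ℕ → ℝ
  | [], m => if m = 0 then 1 else 0
  | Letter.X :: u, m => wordSum t u m / m
  | Letter.Y :: u, m => (∑ j ∈ range m, wordSum t u j) / (m - t)

theorem wordSum_nonneg {t : ℝ} (ht : t < 1) (u : List Letter) (m : ℕ) : 0 ≤ wordSum t u m := by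
  induction u generalizing m with
  | nil => rw [wordSum]; split <;> norm_num
  | cons a u ih =>
    cases a with
    | X => exact div_nonneg (ih m) m.cast_nonneg
    | Y =>
      rcases Nat.eq_zero_or_pos m with rfl | hm
      · simp [wordSum]
      · have : (1 : ℝ) ≤ m := by exact_mod_cast hm
        exact div_nonneg (sum_nonneg fun j _ => ih j) (by linarith)

theorem wordSum_apply_zero (t : ℝ) {u : List Letter} (hu : u ≠ []) : wordSum t u 0 = 0 := by
  match u, hu with
  | Letter.X :: u, _ => simp [wordSum]
  | Letter.Y :: u, _ => simp [wordSum]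

section Summability

theorem sum_range_one_div_sqrt_le (m : ℕ) :
    ∑ j ∈ range (m + 1), 1 / √(j : ℝ) ≤ 2 * √(m : ℝ) := by
  induction m with
  | zero => simp
  | succ m ih =>
    rw [sum_range_succ]
    refine (add_le_add_left ih _).trans ?_
    have hb : 0 < √((m + 1 : ℕ) : ℝ) := Real.sqrt_pos.2 (by positivity)
    have h2 := Real.sq_sqrt (Nat.cast_nonneg (α := ℝ) m)
    have h3 := Real.sq_sqrt (Nat.cast_nonneg (α := ℝ) (m + 1))
    have h4 : √((m + 1 : ℕ) : ℝ) ^ 2 = √(m : ℝ) ^ 2 + 1 := by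
      rw [h2, h3]
      push_cast
      rfl
    rw [← le_sub_iff_add_le', div_le_iff₀ hb]
    -- With a = √m and b = √(m+1): 1 = (b - a)(b + a) ≤ 2b(b - a).
    nlinarith [sq_nonneg (√((m + 1 : ℕ) : ℝ) - √(m : ℝ))]

/-- The rate m^(-1/2) is preserved by both letters: summation turns it into √m, and division by m -
t restores it. One leading x then yields the summable rate m^(-3/2). -/
theorem exists_wordSum_le {t : ℝ} (ht : t ≤ 1 / 2) (u : List Letter) :
    ∃ c : ℝ, 0 ≤ c ∧ ∀ m : ℕ, 1 ≤ m → wordSum t u m ≤ c / √(m : ℝ) := by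
  induction u with
  | nil =>
    refine ⟨0, le_rfl, fun m hm => ?_⟩
    rw [wordSum, if_neg (by omega), zero_div]
  | cons a u ih =>
    obtain ⟨c, hc, h⟩ := ih
    cases a with
    | X =>
      refine ⟨c, hc, fun m hm => le_trans ?_ (h m hm)⟩
      exact div_le_self (wordSum_nonneg (by linarith) u m) (by exact_mod_cast hm)
    | Y =>
      -- The outer 2 comes from m - t ≥ m/2, the 1 from the term j = 0, and 2c from the sum of c/√j.
      refine ⟨2 * (1 + 2 * c), by positivity, fun m hm => ?_⟩
      have hm' : (1 : ℝ) ≤ m := by exact_mod_cast hm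
      have hs : 1 ≤ √(m : ℝ) := Real.one_le_sqrt.2 hm'
      have h0 : wordSum t u 0 ≤ 1 := by
        rcases eq_or_ne u [] with rfl | hu
        · simp [wordSum]
        · rw [wordSum_apply_zero t hu]
          exact zero_le_one
      have hterm (j : ℕ) : wordSum t u j ≤ (if j = 0 then 1 else 0) + c * (1 / √(j : ℝ)) := by
        rcases Nat.eq_zero_or_pos j with rfl | hj
        · simpa using h0
        · rw [if_neg hj.ne', zero_add, mul_one_div]
          exact h j hj
      have hsum : ∑ j ∈ range m, wordSum t u j ≤ (1 + 2 * c) * √(m : ℝ) := by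
        calc ∑ j ∈ range m, wordSum t u j
            ≤ ∑ j ∈ range m, ((if j = 0 then 1 else 0) + c * (1 / √(j : ℝ))) :=
              sum_le_sum fun j _ => hterm j
          _ ≤ 1 + c * ∑ j ∈ range (m + 1), 1 / √(j : ℝ) := by
              rw [sum_add_distrib, ← mul_sum]
              gcongr
              · rw [sum_ite_eq']
                split <;> norm_num
              · omega
          _ ≤ 1 + c * (2 * √(m : ℝ)) := by
              gcongr
              exact sum_range_one_div_sqrt_le m
          _ ≤ (1 + 2 * c) * √(m : ℝ) := by nlinarith
      rw [wordSum]
      calc (∑ j ∈ range m, wordSum t u j) / (m - t)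
          ≤ (1 + 2 * c) * √(m : ℝ) / (m / 2) := by
            gcongr
            linarith
        _ = 2 * (1 + 2 * c) / √(m : ℝ) := by
            have h2 := Real.mul_self_sqrt (Nat.cast_nonneg (α := ℝ) m)
            have : (m : ℝ) ≠ 0 := by positivity
            field_simp
            rw [Real.sq_sqrt (Nat.cast_nonneg m)]

theorem summable_wordSum {t : ℝ} (ht : t ≤ 1 / 2) (u : List Letter) :
    Summable (wordSum t (Letter.X :: u)) := by
  obtain ⟨c, hc, h⟩ := exists_wordSum_le ht u
  have hs : Summable fun m : ℕ => c * (1 / (m : ℝ) ^ (3 / 2 : ℝ)) :=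
    (Real.summable_one_div_nat_rpow.2 (by norm_num)).mul_left c
  refine Summable.of_nonneg_of_le (fun m => wordSum_nonneg (by linarith) _ m) (fun m => ?_) hs
  rcases Nat.eq_zero_or_pos m with rfl | hm
  · simp [wordSum]
  · have hm' : (0 : ℝ) < m := by exact_mod_cast hm
    have h1 : (m : ℝ) ^ (3 / 2 : ℝ) = √(m : ℝ) * m := by
      rw [Real.sqrt_eq_rpow, ← Real.rpow_add_one hm'.ne']
      norm_num
    rw [wordSum, h1, mul_one_div, ← div_div]
    gcongr
    exact h m hm

end Summability

/-! ### Connected sums and duality. -/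

section ConnectedSum

/-- The product `(1 - t) (2 - t) ⋯ (n - t)`. -/
def shiftFactorial (t : ℝ) (n : ℕ) : ℝ := ∏ j ∈ range n, ((j : ℝ) + 1 - t)

theorem shiftFactorial_pos {t : ℝ} (ht : t < 1) (n : ℕ) : 0 < shiftFactorial t n :=
  prod_pos fun j _ => by have : (0 : ℝ) ≤ j := j.cast_nonneg; linarith

theorem shiftFactorial_succ (t : ℝ) (n : ℕ) :
    shiftFactorial t (n + 1) = shiftFactorial t n * ((n : ℝ) + 1 - t) := by
  rw [shiftFactorial, prod_range_succ, shiftFactorial]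

/-- The connector of the connected sums. -/
def connector (t : ℝ) (m n : ℕ) : ℝ :=
  shiftFactorial t m * shiftFactorial t n / shiftFactorial t (m + n)

theorem connector_comm (t : ℝ) (m n : ℕ) : connector t m n = connector t n m := by
  rw [connector, connector, mul_comm, add_comm]

theorem connector_nonneg {t : ℝ} (ht : t < 1) (m n : ℕ) : 0 ≤ connector t m n :=
  div_nonneg (mul_nonneg (shiftFactorial_pos ht m).le (shiftFactorial_pos ht n).le)
    (shiftFactorial_pos ht _).le

theorem connector_zero_right {t : ℝ} (ht : t < 1) (m : ℕ) : connector t m 0 = 1 := by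
  rw [connector, add_zero, shiftFactorial, shiftFactorial, prod_range_zero, mul_one]
  exact div_self (shiftFactorial_pos ht m).ne'

theorem connector_succ {t : ℝ} (ht : t < 1) (m n : ℕ) :
    connector t m (n + 1) * ((m : ℝ) + n + 1 - t) = connector t m n * ((n : ℝ) + 1 - t) := by
  have h := (shiftFactorial_pos ht (m + n)).ne'
  have hmn : ((m + n : ℕ) : ℝ) + 1 - t ≠ 0 := by
    have : (0 : ℝ) ≤ (m + n : ℕ) := Nat.cast_nonneg _
    linarith
  rw [connector, connector, ← add_assoc, shiftFactorial_succ, shiftFactorial_succ]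
  push_cast at hmn ⊢
  field_simp

/-- The recursion for the connector in difference form, which makes the sum over n telescope. -/
theorem connector_sub {t : ℝ} (ht : t < 1) {m : ℕ} (hm : 1 ≤ m) (n : ℕ) :
    connector t m (n + 1) / ((n : ℝ) + 1 - t) =
      connector t m n / m - connector t m (n + 1) / m := by
  have h := connector_succ ht m n
  have h1 : (n : ℝ) + 1 - t ≠ 0 := by have : (0 : ℝ) ≤ n := n.cast_nonneg; linarith
  have h2 : (m : ℝ) ≠ 0 := by positivity
  field_simp
  linarith

/-- The connector is nonincreasing in m and equals (1 - t)/(n + 1 - t) at m = 1. -/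
theorem connector_le {t : ℝ} (ht0 : 0 ≤ t) (ht : t < 1) {m : ℕ} (hm : 1 ≤ m) (n : ℕ) :
    connector t m n ≤ 1 / ((n : ℝ) + 1 - t) := by
  have hn : (0 : ℝ) ≤ n := n.cast_nonneg
  induction m, hm using Nat.le_induction with
  | base =>
    rw [connector, add_comm 1 n, shiftFactorial_succ t n, shiftFactorial, prod_range_one]
    have h := (shiftFactorial_pos ht n).ne'
    rw [mul_comm, mul_div_mul_left _ _ h]
    gcongr
    · linarith
    · simp; linarith
  | succ m hm ih =>
    refine le_trans ?_ ih
    have h := connector_succ ht n m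
    rw [connector_comm t n, connector_comm t n] at h
    have hm' : (0 : ℝ) ≤ m := m.cast_nonneg
    have h1 := connector_nonneg ht (m + 1) n
    have h2 : (0 : ℝ) < (m : ℝ) + 1 - t := by linarith
    nlinarith [mul_nonneg hn h1]

theorem tendsto_connector {t : ℝ} (ht0 : 0 ≤ t) (ht : t < 1) {m : ℕ} (hm : 1 ≤ m) :
    Tendsto (connector t m) atTop (𝓝 0) := by
  refine squeeze_zero (fun n => connector_nonneg ht m n) (fun n => connector_le ht0 ht hm n) ?_
  refine tendsto_const_nhds.div_atTop ?_
  exact tendsto_atTop_add_const_right _ _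
    (tendsto_atTop_add_const_right _ _ tendsto_natCast_atTop_atTop)

theorem hasSum_connector {t : ℝ} (ht0 : 0 ≤ t) (ht : t < 1) {m : ℕ} (hm : 1 ≤ m) (n : ℕ) :
    HasSum (fun k : ℕ => connector t m (n + k + 1) / (((n + k : ℕ) : ℝ) + 1 - t))
      (connector t m n / m) := by
  rw [hasSum_iff_tendsto_nat_of_nonneg]
  · have h (N : ℕ) :
        ∑ k ∈ range N, connector t m (n + k + 1) / (((n + k : ℕ) : ℝ) + 1 - t) =
          connector t m n / m - connector t m (n + N) / m := by
      simp_rw [connector_sub ht hm]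
      exact sum_range_sub' (fun k => connector t m (n + k) / m) N
    simp_rw [h]
    have h2 : Tendsto (fun N => connector t m (n + N) / m) atTop (𝓝 (0 / m)) := by
      refine Tendsto.div_const ?_ _
      exact (tendsto_connector ht0 ht hm).comp
        (tendsto_atTop_mono (fun N => Nat.le_add_left N n) tendsto_id)
    simpa using tendsto_const_nhds.sub h2
  · intro k
    have : (0 : ℝ) ≤ (n + k : ℕ) := Nat.cast_nonneg _
    exact div_nonneg (connector_nonneg ht _ _) (by linarith)

theorem tsum_connector {t : ℝ} (ht0 : 0 ≤ t) (ht : t < 1) {m : ℕ} (hm : 1 ≤ m) (n : ℕ) :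
    ∑' a : ℕ, (if n < a then ENNReal.ofReal (connector t m a / (a - t)) else 0) =
      ENNReal.ofReal (connector t m n / m) := by
  have h := hasSum_connector ht0 ht hm n
  rw [← h.tsum_eq, ENNReal.ofReal_tsum_of_nonneg _ h.summable]
  · have hinj : Function.Injective fun k : ℕ => n + k + 1 := fun a b hab => by
      simpa using hab
    rw [← hinj.tsum_eq]
    · refine tsum_congr fun k => ?_
      rw [if_pos (by omega)]
      push_cast
      rfl
    · intro a ha
      have hna : n < a := by
        by_contra h
        simp [h] at ha
      exact ⟨a - n - 1, by simp only; omega⟩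
  · intro k
    have : (0 : ℝ) ≤ (n + k : ℕ) := Nat.cast_nonneg _
    exact div_nonneg (connector_nonneg ht _ _) (by linarith)

/-- The connected sum of two words. -/
def connectedSum (t : ℝ) (u v : List Letter) : ENNReal :=
  ∑' (m : ℕ) (n : ℕ), ENNReal.ofReal (wordSum t u m * connector t m n * wordSum t v n)

theorem connectedSum_comm (t : ℝ) (u v : List Letter) :
    connectedSum t u v = connectedSum t v u := by
  rw [connectedSum, ENNReal.tsum_comm, connectedSum]
  refine tsum_congr fun m => tsum_congr fun n => ?_
  rw [connector_comm]
  congr 1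
  ring

theorem connectedSum_nil_right {t : ℝ} (ht : t < 1) (u : List Letter) :
    connectedSum t u [] = ∑' m : ℕ, ENNReal.ofReal (wordSum t u m) := by
  refine tsum_congr fun m => ?_
  rw [tsum_eq_single 0]
  · simp [wordSum, connector_zero_right ht]
  · intro n hn
    simp [wordSum, hn]

/-- The factor 1/m of the leading x is traded, by `tsum_connector`, for a sum over a > n of 1/(a -
t), which is what a leading y contributes on the right. That identity needs m ≥ 1; u ≠ [] makes the
terms with m = 0 vanish. -/
theorem connectedSum_transport {t : ℝ} (ht0 : 0 ≤ t) (ht : t < 1) {u : List Letter} (hu : u ≠ [])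
    (v : List Letter) :
    connectedSum t (Letter.X :: u) v = connectedSum t u (Letter.Y :: v) := by
  refine tsum_congr fun m => ?_
  rcases Nat.eq_zero_or_pos m with rfl | hm
  · simp [wordSum, wordSum_apply_zero t hu]
  have hL (n : ℕ) : ENNReal.ofReal (wordSum t (Letter.X :: u) m * connector t m n * wordSum t v n) =
      ∑' a : ℕ, (if n < a then ENNReal.ofReal
        (wordSum t u m * wordSum t v n * (connector t m a / (a - t))) else 0) := by
    have h1 : wordSum t (Letter.X :: u) m * connector t m n * wordSum t v n =
        wordSum t u m * wordSum t v n * (connector t m n / m) := by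
      rw [wordSum]
      ring
    have h0 := mul_nonneg (wordSum_nonneg ht u m) (wordSum_nonneg ht v n)
    rw [h1, ENNReal.ofReal_mul h0, ← tsum_connector ht0 ht hm, ← ENNReal.tsum_mul_left]
    refine tsum_congr fun a => ?_
    split
    · rw [ENNReal.ofReal_mul h0]
    · rw [mul_zero]
  have hR (a : ℕ) : ENNReal.ofReal (wordSum t u m * connector t m a * wordSum t (Letter.Y :: v) a) =
      ∑' n : ℕ, (if n < a then ENNReal.ofReal
        (wordSum t u m * wordSum t v n * (connector t m a / (a - t))) else 0) := by
    have h1 : wordSum t u m * connector t m a * wordSum t (Letter.Y :: v) a =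
        ∑ n ∈ range a, wordSum t u m * wordSum t v n * (connector t m a / (a - t)) := by
      rw [wordSum, ← sum_mul, ← mul_sum]
      ring
    rw [h1, ENNReal.ofReal_sum_of_nonneg, tsum_eq_sum (s := range a)]
    · refine sum_congr rfl fun n hn => ?_
      rw [if_pos (mem_range.1 hn)]
    · intro n hn
      rw [if_neg (by simpa using hn)]
    · intro n hn
      have : (1 : ℝ) ≤ a := by exact_mod_cast (Nat.zero_le n).trans_lt (mem_range.1 hn)
      exact mul_nonneg (mul_nonneg (wordSum_nonneg ht u m) (wordSum_nonneg ht v n))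
        (div_nonneg (connector_nonneg ht _ _) (by linarith))
  simp_rw [hL, hR]
  exact ENNReal.tsum_comm

/-- The letter exchange. -/
def Letter.swap : Letter → Letter
  | Letter.X => Letter.Y
  | Letter.Y => Letter.X

/-- The dual of a word. -/
def dualWord (u : List Letter) : List Letter := (u.map Letter.swap).reverse

/-- Letters leave the head of the left word and reappear, exchanged, at the head of the right one,
which reverses their order. The final y keeps the left word nonempty whenever an x moves; v ≠ []
serves the same purpose when a y moves. -/
theorem connectedSum_append_Y {t : ℝ} (ht0 : 0 ≤ t) (ht : t < 1) (u v : List Letter) (hv : v ≠ []) :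
    connectedSum t (u ++ [Letter.Y]) v = connectedSum t [] (dualWord (u ++ [Letter.Y]) ++ v) := by
  induction u generalizing v with
  | nil =>
    rw [connectedSum_comm, List.nil_append, ← connectedSum_transport ht0 ht hv, connectedSum_comm]
    rfl
  | cons a u ih =>
    cases a with
    | X =>
      rw [List.cons_append, connectedSum_transport ht0 ht (by simp), ih _ (by simp)]
      simp [dualWord, Letter.swap]
    | Y =>
      rw [List.cons_append, connectedSum_comm, ← connectedSum_transport ht0 ht hv,
        connectedSum_comm, ih _ (by simp)]
      simp [dualWord, Letter.swap]

/-- Duality for the deformed sums. -/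
theorem tsum_wordSum_dualWord {t : ℝ} (ht0 : 0 ≤ t) (ht : t < 1) (u : List Letter) :
    ∑' m : ℕ, ENNReal.ofReal (wordSum t (Letter.X :: (u ++ [Letter.Y])) m) =
      ∑' m : ℕ, ENNReal.ofReal (wordSum t (dualWord (Letter.X :: (u ++ [Letter.Y]))) m) := by
  -- The leading x can move against an empty right word, and the right word is nonempty from then
  -- on.
  rw [← connectedSum_nil_right ht, ← connectedSum_nil_right ht,
    connectedSum_transport ht0 ht (by simp), connectedSum_append_Y ht0 ht _ _ (by simp),
    connectedSum_comm]
  simp [dualWord, Letter.swap]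

end ConnectedSum

end MZV

end

noncomputable section

namespace MZV

open Finset Filter Topology

/-! ### Multiple zeta values as iterated sums. -/

section ZetaSeries

/-- The truncated nested sums attached to an index: `indexSum k m` collects the terms whose largest
summation index is `m`. -/
def indexSum : List ℕ → ℕ → ℝ
  | [], m => if m = 0 then 1 else 0
  | k :: ks, m => (∑ j ∈ range m, indexSum ks j) / (m : ℝ) ^ k

theorem indexSum_nonneg (k : List ℕ) (m : ℕ) : 0 ≤ indexSum k m := by
  induction k generalizing m with
  | nil => rw [indexSum]; split <;> norm_num
  | cons k ks ih => exact div_nonneg (sum_nonneg fun j _ => ih j) (by positivity)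

open Classical in
/-- The nested sum over all indices below the bound `N`, with values in `[0, ∞]`. -/
def boundedZeta (k : List ℕ) (N : ℕ∞) : ENNReal :=
  ∑' n : Fin k.length → ℕ,
    if StrictAnti n ∧ (∀ i, 1 ≤ n i) ∧ ∀ i, (n i : ℕ∞) < N then
      ENNReal.ofReal (∏ i, 1 / (n i : ℝ) ^ k.get i) else 0

theorem strictAnti_cons_iff {r : ℕ} (m : ℕ) (n : Fin r → ℕ) :
    StrictAnti (Fin.cons m n : Fin (r + 1) → ℕ) ↔ (∀ i, n i < m) ∧ StrictAnti n := by
  constructor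
  · intro h
    refine ⟨fun i => ?_, fun i j hij => ?_⟩
    · simpa using h (Fin.succ_pos i)
    · simpa using h (Fin.succ_lt_succ_iff.2 hij)
  · rintro ⟨h0, h⟩ i j hij
    induction j using Fin.cases with
    | zero => exact absurd hij (Fin.not_lt_zero i)
    | succ j =>
      induction i using Fin.cases with
      | zero => simpa using h0 j
      | succ i => simpa using h (Fin.succ_lt_succ_iff.1 hij)

-- The bound N makes induction possible: once the largest index m is split off, the others form the
-- same sum with bound m. The condition 0 < N admits the term m = 0 of the empty index.
open Classical in
theorem boundedZeta_eq (k : List ℕ) {N : ℕ∞} (hN : 0 < N) :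
    boundedZeta k N = ∑' m : ℕ, if (m : ℕ∞) < N then ENNReal.ofReal (indexSum k m) else 0 := by
  induction k generalizing N with
  | nil =>
    let e : Fin ([] : List ℕ).length → ℕ := Fin.elim0
    have hu : ∀ n : Fin ([] : List ℕ).length → ℕ, n = e := fun n => funext fun i => i.elim0
    rw [boundedZeta, tsum_eq_single e fun n hn => (hn (hu n)).elim, if_pos, tsum_eq_single 0]
    · simp [indexSum, hN]
    · intro m hm
      simp [indexSum, hm]
    · exact ⟨fun i => i.elim0, fun i => i.elim0, fun i => i.elim0⟩
  | cons k ks ih =>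
    have h1 : boundedZeta (k :: ks) N = ∑' p : ℕ × (Fin ks.length → ℕ),
        if (1 ≤ p.1 ∧ (p.1 : ℕ∞) < N) ∧
          (StrictAnti p.2 ∧ (∀ i, 1 ≤ p.2 i) ∧ ∀ i, (p.2 i : ℕ∞) < (p.1 : ℕ∞)) then
        ENNReal.ofReal (1 / (p.1 : ℝ) ^ k) * ENNReal.ofReal (∏ i, 1 / (p.2 i : ℝ) ^ ks.get i)
        else 0 := by
      refine ((Fin.consEquiv fun _ : Fin (ks.length + 1) => ℕ).tsum_eq _).symm.trans
        (tsum_congr fun p => ?_)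
      obtain ⟨m, n⟩ := p
      have hiff : (StrictAnti (Fin.cons m n : Fin (ks.length + 1) → ℕ) ∧
          (∀ i, 1 ≤ (Fin.cons m n : Fin (ks.length + 1) → ℕ) i) ∧
          ∀ i, ((Fin.cons m n : Fin (ks.length + 1) → ℕ) i : ℕ∞) < N) ↔
          (1 ≤ m ∧ (m : ℕ∞) < N) ∧
          (StrictAnti n ∧ (∀ i, 1 ≤ n i) ∧ ∀ i, (n i : ℕ∞) < (m : ℕ∞)) := by
        simp only [strictAnti_cons_iff, Fin.forall_fin_succ, Fin.cons_zero, Fin.cons_succ,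
          Nat.cast_lt]
        constructor
        · rintro ⟨⟨a, b⟩, ⟨c, d⟩, e, f⟩
          exact ⟨⟨c, e⟩, b, d, a⟩
        · rintro ⟨⟨c, e⟩, b, d, a⟩
          exact ⟨⟨a, b⟩, ⟨c, d⟩, e, fun i => lt_trans (Nat.cast_lt.2 (a i)) e⟩
      have hprod : ENNReal.ofReal (∏ i : Fin (ks.length + 1),
          1 / ((Fin.cons m n : Fin (ks.length + 1) → ℕ) i : ℝ) ^ (k :: ks).get i) =
          ENNReal.ofReal (1 / (m : ℝ) ^ k) * ENNReal.ofReal (∏ i, 1 / (n i : ℝ) ^ ks.get i) := by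
        rw [← ENNReal.ofReal_mul (by positivity), Fin.prod_univ_succ]
        rfl
      exact if_congr hiff hprod rfl
    rw [h1, ENNReal.tsum_prod']
    refine tsum_congr fun m => ?_
    rcases Nat.eq_zero_or_pos m with rfl | hm
    · simp [indexSum]
    by_cases hmN : (m : ℕ∞) < N
    · have h2 : ENNReal.ofReal (indexSum (k :: ks) m) =
          ENNReal.ofReal (1 / (m : ℝ) ^ k) * boundedZeta ks m := by
        rw [ih (by exact_mod_cast hm), tsum_eq_sum (s := range m), indexSum, div_eq_mul_one_div,
          mul_comm, ENNReal.ofReal_mul (by positivity),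
          ENNReal.ofReal_sum_of_nonneg fun j _ => indexSum_nonneg ks j]
        · congr 1
          refine sum_congr rfl fun j hj => ?_
          rw [if_pos (by exact_mod_cast mem_range.1 hj)]
        · intro j hj
          rw [if_neg]
          simpa using hj
      rw [if_pos hmN, h2, boundedZeta, ← ENNReal.tsum_mul_left]
      refine tsum_congr fun n => ?_
      rw [mul_ite, mul_zero]
      refine if_congr ?_ rfl rfl
      exact and_iff_right ⟨hm, hmN⟩
    · simp [hmN]

/-- Valid without convergence: for a divergent index both sides take the default value 0. -/
theorem zeta_eq_toReal (k : List ℕ) :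
    zeta k = (∑' m : ℕ, ENNReal.ofReal (indexSum k m)).toReal := by
  classical
  have h := boundedZeta_eq k (N := ⊤) (by simp)
  simp only [ENat.natCast_lt_top, if_true] at h
  rw [← h, boundedZeta, zeta]
  have h2 : ∀ n : Fin k.length → ℕ, 0 ≤ ∏ i, 1 / (n i : ℝ) ^ k.get i := fun n =>
    prod_nonneg fun i _ => by positivity
  rw [ENNReal.tsum_toReal_eq fun n => by split <;> simp]
  have h3 := tsum_subtype {n : Fin k.length → ℕ | StrictAnti n ∧ ∀ i, 1 ≤ n i}
    fun n => ∏ i, 1 / (n i : ℝ) ^ k.get i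
  refine Eq.trans h3 (tsum_congr fun n => ?_)
  by_cases hn : StrictAnti n ∧ ∀ i, 1 ≤ n i
  · rw [Set.indicator_of_mem (by exact hn), if_pos (by simpa using hn), ENNReal.toReal_ofReal (h2 n)]
  · rw [Set.indicator_of_notMem (by exact hn), if_neg (by simpa using hn), ENNReal.toReal_zero]

theorem wordIndex_append_Y_ne_nil (u : List Letter) : wordIndex (u ++ [Letter.Y]) ≠ [] := by
  induction u with
  | nil => simp [wordIndex]
  | cons a u ih =>
    cases a with
    | X =>
      rw [List.cons_append, wordIndex]
      split <;> simp_all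
    | Y => simp [wordIndex]

theorem wordSum_zero_eq_indexSum (u : List Letter) (m : ℕ) :
    wordSum 0 (u ++ [Letter.Y]) m = indexSum (wordIndex (u ++ [Letter.Y])) m := by
  induction u generalizing m with
  | nil => simp [wordSum, wordIndex, indexSum]
  | cons a u ih =>
    cases a with
    | X =>
      rw [List.cons_append, wordSum, wordIndex, ih]
      split
      · next h => exact absurd h (wordIndex_append_Y_ne_nil u)
      · next k ks h => rw [h, indexSum, indexSum, div_div, pow_succ]
    | Y =>
      rw [List.cons_append, wordSum, wordIndex, indexSum]
      simp only [ih, sub_zero, pow_one]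

theorem hasSum_wordSum_zero (u : List Letter) :
    HasSum (wordSum 0 (Letter.X :: (u ++ [Letter.Y])))
      (zeta (wordIndex (Letter.X :: (u ++ [Letter.Y])))) := by
  have hs := summable_wordSum (t := 0) (by norm_num) (u ++ [Letter.Y])
  have h : zeta (wordIndex (Letter.X :: (u ++ [Letter.Y]))) =
      ∑' m, wordSum 0 (Letter.X :: (u ++ [Letter.Y])) m := by
    rw [zeta_eq_toReal, ← List.cons_append]
    simp_rw [← wordSum_zero_eq_indexSum]
    rw [ENNReal.tsum_toReal_eq fun _ => ENNReal.ofReal_ne_top]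
    exact tsum_congr fun m => ENNReal.toReal_ofReal (wordSum_nonneg one_pos _ m)
  rw [h]
  exact hs.hasSum

end ZetaSeries

/-! ### Words as a basis, and linear extension of the sums. -/

section Words

/-- A word as a monomial of `𝔥`. -/
def monomial (u : List Letter) : H := (u.map (FreeAlgebra.ι ℚ)).prod

theorem basis_ofList (u : List Letter) :
    FreeAlgebra.basisFreeMonoid ℚ Letter (FreeMonoid.ofList u) = monomial u := by
  simp [FreeAlgebra.basisFreeMonoid, FreeAlgebra.equivMonoidAlgebraFreeMonoid,
    FreeMonoid.lift_apply, monomial]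

theorem monomial_cons_X (u : List Letter) : monomial (Letter.X :: u) = x * monomial u := rfl

theorem monomial_cons_Y (u : List Letter) : monomial (Letter.Y :: u) = y * monomial u := rfl

theorem monomial_nil : monomial [] = 1 := rfl

theorem monomial_append (u v : List Letter) : monomial (u ++ v) = monomial u * monomial v := by
  simp [monomial]

theorem monomial_X_append_Y (u : List Letter) :
    monomial (Letter.X :: (u ++ [Letter.Y])) = x * monomial u * y := by
  rw [monomial_cons_X, monomial_append, ← mul_assoc, monomial_cons_Y, monomial_nil, mul_one]

theorem span_monomial : Submodule.span ℚ (Set.range monomial) = ⊤ := by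
  have h : Set.range monomial = Set.range (FreeAlgebra.basisFreeMonoid ℚ Letter) := by
    ext w
    constructor
    · rintro ⟨u, rfl⟩
      exact ⟨FreeMonoid.ofList u, basis_ofList u⟩
    · rintro ⟨u, rfl⟩
      exact ⟨FreeMonoid.toList u, (basis_ofList _).symm⟩
  rw [h]
  exact Module.Basis.span_eq _

/-- A property of elements of `𝔥` closed under linear combinations holds if it holds for words. -/
theorem monomial_induction {p : H → Prop} (w : H) (hmon : ∀ u, p (monomial u)) (h0 : p 0)
    (hadd : ∀ a b, p a → p b → p (a + b)) (hsmul : ∀ (r : ℚ) a, p a → p (r • a)) : p w := by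
  have hw : w ∈ Submodule.span ℚ (Set.range monomial) := span_monomial ▸ Submodule.mem_top
  induction hw using Submodule.span_induction with
  | mem a ha => obtain ⟨u, rfl⟩ := ha; exact hmon u
  | zero => exact h0
  | add a b _ _ ha hb => exact hadd a b ha hb
  | smul r a _ ha => exact hsmul r a ha

/-- Linear maps that agree at `1` and at the words `x u y` agree on `𝔥⁰`. -/
theorem H0_linear_ext {M : Type*} [AddCommGroup M] [Module ℚ M] {f g : H →ₗ[ℚ] M}
    (h1 : f 1 = g 1) (h : ∀ u, f (monomial (Letter.X :: (u ++ [Letter.Y]))) =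
      g (monomial (Letter.X :: (u ++ [Letter.Y])))) {w : H} (hw : w ∈ H0) : f w = g w := by
  obtain ⟨q, v, rfl⟩ := (mem_H0_iff w).1 hw
  have hv : f (x * v * y) = g (x * v * y) := by
    clear hw
    induction v using monomial_induction with
    | hmon u => rw [← monomial_X_append_Y, h]
    | h0 => simp
    | hadd a b ha hb => rw [mul_add, add_mul, map_add, map_add, ha, hb]
    | hsmul r a ha => rw [mul_smul_comm, smul_mul_assoc, map_smul, map_smul, ha]
  rw [map_add, map_add, Algebra.algebraMap_eq_smul_one, map_smul, map_smul, h1, hv]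

/-- The extension of `Z` to all words used to define it. -/
def ZExt : H →ₗ[ℚ] ℝ :=
  (FreeAlgebra.basisFreeMonoid ℚ Letter).constr ℚ
    fun w : FreeMonoid Letter => zeta (wordIndex (FreeMonoid.toList w))

theorem ZExt_monomial (u : List Letter) : ZExt (monomial u) = zeta (wordIndex u) := by
  rw [← basis_ofList, ZExt, Module.Basis.constr_basis, FreeMonoid.toList_ofList]

/-- The linear extension of `u ↦ wordSum 0 u m`. -/
def topSum (m : ℕ) : H →ₗ[ℚ] ℝ :=
  (FreeAlgebra.basisFreeMonoid ℚ Letter).constr ℚ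
    fun w : FreeMonoid Letter => wordSum 0 (FreeMonoid.toList w) m

theorem topSum_monomial (m : ℕ) (u : List Letter) : topSum m (monomial u) = wordSum 0 u m := by
  rw [← basis_ofList, topSum, Module.Basis.constr_basis, FreeMonoid.toList_ofList]

theorem topSum_x_mul (m : ℕ) (w : H) : topSum m (x * w) = topSum m w / m := by
  induction w using monomial_induction with
  | hmon u => rw [← monomial_cons_X, topSum_monomial, topSum_monomial, wordSum]
  | h0 => simp
  | hadd a b ha hb => rw [mul_add, map_add, map_add, ha, hb, add_div]
  | hsmul r a ha => rw [mul_smul_comm, map_smul, map_smul, ha, smul_div_assoc]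

theorem topSum_y_mul (m : ℕ) (w : H) :
    topSum m (y * w) = (∑ j ∈ range m, topSum j w) / m := by
  induction w using monomial_induction with
  | hmon u =>
    rw [← monomial_cons_Y]
    simp only [topSum_monomial, wordSum, sub_zero]
  | h0 => simp
  | hadd a b ha hb => simp only [mul_add, map_add, ha, hb, sum_add_distrib, add_div]
  | hsmul r a ha => rw [mul_smul_comm, map_smul, ha]; simp only [map_smul, ← smul_sum, smul_div_assoc]

theorem hasSum_topSum {w : H} (hw : w ∈ H0) : HasSum (fun m => topSum m w) (ZExt w) := by
  obtain ⟨q, v, rfl⟩ := (mem_H0_iff w).1 hw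
  have hone : HasSum (fun m => topSum m 1) (ZExt 1) := by
    have h : ZExt 1 = 1 := Z_one
    have h2 : (fun m => topSum m 1) = fun m => if m = 0 then (1 : ℝ) else 0 := by
      funext m
      rw [← monomial_nil, topSum_monomial, wordSum]
    rw [h, h2]
    exact hasSum_ite_eq 0 1
  have hv : HasSum (fun m => topSum m (x * v * y)) (ZExt (x * v * y)) := by
    clear hw
    induction v using monomial_induction with
    | hmon u =>
      rw [← monomial_X_append_Y, ZExt_monomial]
      simp only [topSum_monomial]
      exact hasSum_wordSum_zero u
    | h0 => simp
    | hadd a b ha hb =>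
      simp only [mul_add, add_mul, map_add]
      exact ha.add hb
    | hsmul r a ha =>
      simp only [mul_smul_comm, smul_mul_assoc, map_smul]
      exact ha.const_smul r
  simp only [map_add, Algebra.algebraMap_eq_smul_one, map_smul]
  exact (hone.const_smul q).add hv

end Words

/-! ### The anti-automorphism and the derivations it exchanges. -/

section Duality

/-- The anti-automorphism of `𝔥` that exchanges `x` and `y`. -/
def dual : H →ₗ[ℚ] H :=
  (MulOpposite.opLinearEquiv ℚ).symm.toLinearMap.comp
    (FreeAlgebra.lift ℚ fun a => MulOpposite.op (FreeAlgebra.ι ℚ (Letter.swap a))).toLinearMap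

theorem dual_mul (v w : H) : dual (v * w) = dual w * dual v := by simp [dual]

theorem dual_one : dual 1 = 1 := by simp [dual]

theorem dual_x : dual x = y := by simp [dual, x, y, Letter.swap]

theorem dual_y : dual y = x := by simp [dual, x, y, Letter.swap]

theorem dual_monomial (u : List Letter) : dual (monomial u) = monomial (dualWord u) := by
  induction u with
  | nil => exact dual_one
  | cons a u ih =>
    have h : dualWord (a :: u) = dualWord u ++ [a.swap] := by simp [dualWord]
    rw [h, monomial_append, ← ih]
    cases a with
    | X => rw [monomial_cons_X, dual_mul, dual_x, Letter.swap, monomial_cons_Y, monomial_nil, mul_one]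
    | Y => rw [monomial_cons_Y, dual_mul, dual_y, Letter.swap, monomial_cons_X, monomial_nil, mul_one]

theorem dual_pow (w : H) (n : ℕ) : dual (w ^ n) = dual w ^ n := by
  induction n with
  | zero => simp [dual_one]
  | succ n ih => rw [pow_succ, dual_mul, ih, pow_succ']

theorem dual_derX (n : ℕ) (w : H) : dual (derX n w) = derY n (dual w) := by
  induction w using FreeAlgebra.induction with
  | grade0 r =>
    have hX : derX n 1 = 0 := by simpa using derX_mul n 1 1
    have hY : derY n 1 = 0 := by simpa using derY_mul n 1 1
    simp only [Algebra.algebraMap_eq_smul_one, map_smul, dual_one, hX, hY, map_zero]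
  | grade1 a =>
    cases a with
    | X =>
      change dual (derX n x) = derY n (dual x)
      rw [derX_x, dual_mul, dual_pow, dual_x, dual_y, derY_y]
    | Y =>
      change dual (derX n y) = derY n (dual y)
      rw [derX_y, dual_y, derY_x, map_zero]
  | mul a b ha hb =>
    rw [derX_mul, map_add, dual_mul, dual_mul, dual_mul, derY_mul, ha, hb, add_comm]
  | add a b ha hb => simp only [map_add, ha, hb]

theorem derX_mem_H0 (n : ℕ) {w : H} (hw : w ∈ H0) : derX n w ∈ H0 := by
  obtain ⟨q, v, rfl⟩ := (mem_H0_iff w).1 hw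
  have h1 : derX n 1 = 0 := by simpa using derX_mul n 1 1
  refine (mem_H0_iff _).2 ⟨0, y ^ n * v + derX n v, ?_⟩
  rw [map_add, Algebra.algebraMap_eq_smul_one, map_smul, h1, derX_mul, derX_mul, derX_x, derX_y]
  simp only [map_zero, smul_zero]
  noncomm_ring

end Duality

/-! ### Ohno's relation and the conclusion. -/

section Ohno

open PowerSeries in
theorem shiftCoeff_x_mul (n : ℕ) (w : H) : shiftCoeff n (x * w) = x * shiftCoeff n w := by
  rw [shiftCoeff_apply, map_mul, shiftHom_x, coeff_C_mul, shiftCoeff_apply]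

open PowerSeries in
theorem shiftCoeff_y_mul (n : ℕ) (w : H) : shiftCoeff n (y * w) =
    ∑ p ∈ antidiagonal n, x ^ p.1 * (y * shiftCoeff p.2 w) := by
  rw [shiftCoeff_apply, map_mul, shiftHom_y, coeff_mul]
  refine sum_congr rfl fun p _ => ?_
  rw [coeff_mk, mul_assoc, shiftCoeff_apply]

open PowerSeries in
theorem shiftCoeff_mem_H0 (n : ℕ) {w : H} (hw : w ∈ H0) : shiftCoeff n w ∈ H0 := by
  obtain ⟨q, v, rfl⟩ := (mem_H0_iff w).1 hw
  have h1 : shiftCoeff n 1 = if n = 0 then 1 else 0 := by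
    rw [shiftCoeff_apply, map_one, coeff_one]
  have h2 : shiftCoeff n (x * v * y) =
      x * (∑ p ∈ antidiagonal n, shiftCoeff p.1 v * x ^ p.2) * y := by
    rw [mul_assoc, shiftCoeff_x_mul, shiftCoeff_apply, map_mul, shiftHom_y, coeff_mul, mul_assoc,
      sum_mul]
    congr 1
    refine sum_congr rfl fun p _ => ?_
    rw [coeff_mk, mul_assoc, shiftCoeff_apply]
  refine (mem_H0_iff _).2 ⟨if n = 0 then q else 0,
    ∑ p ∈ antidiagonal n, shiftCoeff p.1 v * x ^ p.2, ?_⟩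
  rw [map_add, h2, Algebra.algebraMap_eq_smul_one, map_smul, h1]
  congr 1
  split <;> simp [Algebra.algebraMap_eq_smul_one]

theorem topSum_x_pow_mul (m i : ℕ) (w : H) :
    topSum m (x ^ i * w) = topSum m w / (m : ℝ) ^ i := by
  induction i with
  | zero => simp
  | succ i ih => rw [pow_succ', mul_assoc, topSum_x_mul, ih, div_div, pow_succ]

theorem topSum_shiftCoeff_y_mul (m n : ℕ) (w : H) : topSum m (shiftCoeff n (y * w)) =
    ∑ p ∈ antidiagonal n,
      1 / (m : ℝ) ^ (p.1 + 1) * ∑ j ∈ range m, topSum j (shiftCoeff p.2 w) := by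
  rw [shiftCoeff_y_mul, map_sum]
  refine sum_congr rfl fun p _ => ?_
  rw [topSum_x_pow_mul, topSum_y_mul, div_div, pow_succ', one_div_mul_eq_div]

/-- Positivity allows the sums over m and over powers of t to be exchanged in [0, ∞]. -/
theorem topSum_shiftCoeff_nonneg (u : List Letter) (m n : ℕ) :
    0 ≤ topSum m (shiftCoeff n (monomial u)) := by
  induction u generalizing m n with
  | nil =>
    rw [monomial_nil, shiftCoeff_apply, map_one, PowerSeries.coeff_one]
    split
    · rw [← monomial_nil, topSum_monomial]
      exact wordSum_nonneg one_pos _ _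
    · simp
  | cons a u ih =>
    cases a with
    | X =>
      rw [monomial_cons_X, shiftCoeff_x_mul, topSum_x_mul]
      exact div_nonneg (ih m n) m.cast_nonneg
    | Y =>
      rw [monomial_cons_Y, topSum_shiftCoeff_y_mul]
      exact sum_nonneg fun p _ => mul_nonneg (by positivity) (sum_nonneg fun j _ => ih j _)

/-- The expansion of the deformed sums in powers of the parameter. -/
theorem hasSum_topSum_shiftCoeff {t : ℝ} (ht0 : 0 ≤ t) (ht : t < 1) (u : List Letter) (m : ℕ) :
    HasSum (fun n => t ^ n * topSum m (shiftCoeff n (monomial u))) (wordSum t u m) := by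
  induction u generalizing m with
  | nil =>
    have h : (fun n => t ^ n * topSum m (shiftCoeff n (monomial []))) =
        fun n => if n = 0 then wordSum t [] m else 0 := by
      funext n
      rw [monomial_nil, shiftCoeff_apply, map_one, PowerSeries.coeff_one]
      split
      · next h => rw [h, pow_zero, one_mul, ← monomial_nil, topSum_monomial, wordSum, wordSum]
      · simp
    rw [h]
    exact hasSum_ite_eq 0 _
  | cons a u ih =>
    cases a with
    | X =>
      simp only [monomial_cons_X, shiftCoeff_x_mul, topSum_x_mul, wordSum, ← mul_div_assoc]
      exact (ih m).div_const _
    | Y =>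
      simp only [monomial_cons_Y, topSum_shiftCoeff_y_mul, wordSum]
      rcases Nat.eq_zero_or_pos m with rfl | hm
      · simp
      have hm' : (1 : ℝ) ≤ m := by exact_mod_cast hm
      -- The claim for a leading y is the Cauchy product of this geometric series with the inductive
      -- expansion of the inner sum.
      have hf : HasSum (fun i : ℕ => t ^ i * (1 / (m : ℝ) ^ (i + 1))) (1 / (m - t)) := by
        have hg := (hasSum_geometric_of_lt_one (r := t / m) (by positivity)
          ((div_lt_one (by positivity)).2 (by linarith))).mul_left (1 / (m : ℝ))
        have hval : 1 / ((m : ℝ) - t) = 1 / (m : ℝ) * (1 - t / m)⁻¹ := by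
          rw [one_div, one_div, ← mul_inv, mul_sub, mul_one, mul_div_cancel₀ _ (by positivity)]
        rw [hval]
        refine hg.congr_fun fun i => ?_
        rw [div_pow, pow_succ]
        field_simp
      have hg : HasSum (fun n => t ^ n * ∑ j ∈ range m, topSum j (shiftCoeff n (monomial u)))
          (∑ j ∈ range m, wordSum t u j) := by
        simp only [mul_sum]
        exact hasSum_sum fun j _ => ih j
      have hsum := (summable_norm_sum_mul_antidiagonal_of_summable_norm hf.summable.norm
        hg.summable.norm).of_norm
      have htsum := tsum_mul_tsum_eq_tsum_sum_antidiagonal_of_summable_norm hf.summable.norm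
        hg.summable.norm
      rw [hf.tsum_eq, hg.tsum_eq] at htsum
      have h := hsum.hasSum
      rw [← htsum, one_div_mul_eq_div] at h
      refine h.congr_fun fun n => ?_
      rw [mul_sum]
      refine sum_congr rfl fun p hp => ?_
      rw [← mem_antidiagonal.1 hp, pow_add]
      ring

theorem hasSum_ZExt_shiftCoeff {t : ℝ} (ht0 : 0 ≤ t) (ht : t ≤ 1 / 2) (u : List Letter) :
    HasSum (fun n => t ^ n * ZExt (shiftCoeff n (monomial (Letter.X :: (u ++ [Letter.Y])))))
      (∑' m, ENNReal.ofReal (wordSum t (Letter.X :: (u ++ [Letter.Y])) m)).toReal := by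
  set w := Letter.X :: (u ++ [Letter.Y]) with hw
  have ht1 : t < 1 := by linarith
  have hmem : monomial w ∈ H0 := by
    rw [hw, monomial_X_append_Y]
    exact (mem_H0_iff _).2 ⟨0, monomial u, by simp⟩
  have hZ (n : ℕ) := hasSum_topSum (shiftCoeff_mem_H0 n hmem)
  have hZ0 (n : ℕ) : 0 ≤ ZExt (shiftCoeff n (monomial w)) :=
    (hZ n).nonneg fun m => topSum_shiftCoeff_nonneg w m n
  have hE : ∑' m, ENNReal.ofReal (wordSum t w m) =
      ∑' n, ENNReal.ofReal (t ^ n * ZExt (shiftCoeff n (monomial w))) := by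
    have h1 (m : ℕ) : ENNReal.ofReal (wordSum t w m) =
        ∑' n, ENNReal.ofReal (t ^ n * topSum m (shiftCoeff n (monomial w))) := by
      have h := hasSum_topSum_shiftCoeff ht0 ht1 w m
      rw [← h.tsum_eq, ENNReal.ofReal_tsum_of_nonneg _ h.summable]
      exact fun n => mul_nonneg (by positivity) (topSum_shiftCoeff_nonneg w m n)
    have h2 (n : ℕ) : ENNReal.ofReal (t ^ n * ZExt (shiftCoeff n (monomial w))) =
        ∑' m, ENNReal.ofReal (t ^ n * topSum m (shiftCoeff n (monomial w))) := by
      have h := (hZ n).mul_left (t ^ n)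
      rw [← h.tsum_eq, ENNReal.ofReal_tsum_of_nonneg _ h.summable]
      exact fun m => mul_nonneg (by positivity) (topSum_shiftCoeff_nonneg w m n)
    simp_rw [h1, h2]
    exact ENNReal.tsum_comm
  have hfin : ∑' m, ENNReal.ofReal (wordSum t w m) ≠ ⊤ :=
    (summable_wordSum ht (u ++ [Letter.Y])).tsum_ofReal_ne_top
  rw [hE] at hfin ⊢
  have h := ENNReal.hasSum_toReal hfin
  rw [← ENNReal.tsum_toReal_eq fun _ => ENNReal.ofReal_ne_top] at h
  simpa only [ENNReal.toReal_ofReal (mul_nonneg (pow_nonneg ht0 _) (hZ0 _))] using h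

/-- A real power series that vanishes on `(0, 1 / 2]` has vanishing coefficients. -/
theorem eq_zero_of_hasSum_zero {d : ℕ → ℝ}
    (h : ∀ t : ℝ, 0 < t → t ≤ 1 / 2 → HasSum (fun n => t ^ n * d n) 0) (n : ℕ) : d n = 0 := by
  induction n using Nat.strong_induction_on with
  | _ n ih =>
    -- The earlier coefficients vanish by induction, so the series may be divided by tⁿ.
    have hshift (t : ℝ) (ht0 : 0 < t) (ht : t ≤ 1 / 2) :
        HasSum (fun k => t ^ k * d (k + n)) 0 := by
      have h1 := (hasSum_nat_add_iff' n).2 (h t ht0 ht)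
      rw [sum_eq_zero fun i hi => by rw [ih i (mem_range.1 hi), mul_zero], sub_zero] at h1
      have h2 := h1.mul_left (t ^ n)⁻¹
      rw [mul_zero] at h2
      refine h2.congr_fun fun k => ?_
      rw [pow_add]
      field_simp
    have hs : Summable fun k => (1 / 2 : ℝ) ^ k * |d (k + 1 + n)| := by
      have h1 := (summable_nat_add_iff 1).2 (hshift (1 / 2) (by norm_num) le_rfl).summable.abs
      refine (h1.mul_left 2).congr fun k => ?_
      rw [abs_mul, abs_of_nonneg (by positivity), pow_succ]
      ring
    set M := ∑' k, (1 / 2 : ℝ) ^ k * |d (k + 1 + n)| with hM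
    -- Up to sign d n is the tail t ∑ tᵏ d (k+1+n), and tᵏ ≤ 2⁻ᵏ bounds it by tM with M independent
    -- of t.
    have hbound (t : ℝ) (ht0 : 0 < t) (ht : t ≤ 1 / 2) : |d n| ≤ t * M := by
      have h1 := (hasSum_nat_add_iff' 1).2 (hshift t ht0 ht)
      rw [sum_range_one, pow_zero, one_mul, zero_add, zero_sub] at h1
      rw [← abs_neg, ← h1.tsum_eq, hM, ← tsum_mul_left, ← Real.norm_eq_abs]
      refine tsum_of_norm_bounded (hs.mul_left t).hasSum fun k => ?_
      rw [norm_mul, norm_pow, Real.norm_of_nonneg ht0.le, Real.norm_eq_abs, pow_succ', mul_assoc]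
      gcongr
    have hlim : Tendsto (fun t : ℝ => t * M) (𝓝[>] 0) (𝓝 0) := by
      have h1 : Tendsto (fun t : ℝ => t * M) (𝓝 0) (𝓝 (0 * M)) := tendsto_id.mul_const M
      rw [zero_mul] at h1
      exact h1.mono_left nhdsWithin_le_nhds
    have hle : |d n| ≤ 0 := by
      refine ge_of_tendsto hlim ?_
      filter_upwards [Ioc_mem_nhdsGT (show (0 : ℝ) < 1 / 2 by norm_num)] with t ht
      exact hbound t ht.1 ht.2
    exact abs_nonpos_iff.1 hle

/-- The Ohno relation. -/
theorem ZExt_shiftCoeff_dual (n : ℕ) {w : H} (hw : w ∈ H0) :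
    ZExt (shiftCoeff n (dual w)) = ZExt (shiftCoeff n w) := by
  refine H0_linear_ext (f := ZExt ∘ₗ shiftCoeff n ∘ₗ dual) (g := ZExt ∘ₗ shiftCoeff n) ?_ ?_ hw
  · simp [dual_one]
  · intro u
    have hd : dualWord (Letter.X :: (u ++ [Letter.Y])) =
        Letter.X :: (dualWord u ++ [Letter.Y]) := by
      simp [dualWord, Letter.swap]
    simp only [LinearMap.comp_apply, dual_monomial]
    rw [hd, ← sub_eq_zero]
    refine eq_zero_of_hasSum_zero (d := fun n =>
      ZExt (shiftCoeff n (monomial (Letter.X :: (dualWord u ++ [Letter.Y])))) -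
        ZExt (shiftCoeff n (monomial (Letter.X :: (u ++ [Letter.Y]))))) (fun t ht0 ht => ?_) n
    have h1 := hasSum_ZExt_shiftCoeff ht0.le ht u
    have h2 := hasSum_ZExt_shiftCoeff ht0.le ht (dualWord u)
    rw [tsum_wordSum_dualWord ht0.le (by linarith), hd] at h1
    simpa only [mul_sub, sub_self] using h2.sub h1

theorem sum_ZExt_partialD_shiftCoeff (n : ℕ) {w : H} (hw : w ∈ H0) :
    ∑ i ∈ range (n + 1), ZExt (partialD (i + 1) (shiftCoeff (n - i) w)) = 0 := by
  have hX : ∑ j ∈ range (n + 1), ZExt (shiftCoeff (n - j) (derX (j + 1) w)) =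
      ZExt ((n + 1) • shiftCoeff (n + 1) w) := by
    calc ∑ j ∈ range (n + 1), ZExt (shiftCoeff (n - j) (derX (j + 1) w))
        = ∑ j ∈ range (n + 1), ZExt (shiftCoeff (n - j) (derY (j + 1) (dual w))) :=
          sum_congr rfl fun j _ => by
            rw [← dual_derX, ZExt_shiftCoeff_dual _ (derX_mem_H0 _ hw)]
      _ = ZExt ((n + 1) • shiftCoeff (n + 1) (dual w)) := by
          rw [← map_sum, sum_shiftCoeff_derY]
      _ = ZExt ((n + 1) • shiftCoeff (n + 1) w) := by
          rw [map_nsmul, map_nsmul, ZExt_shiftCoeff_dual _ hw]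
  have h := congrArg ZExt (sum_partialD_shiftCoeff n w)
  rw [map_add, sum_shiftCoeff_derY, map_sum, map_sum, hX] at h
  simpa using h

theorem ZExt_partialD (n : ℕ) {w : H} (hw : w ∈ H0) : ZExt (partialD (n + 1) w) = 0 := by
  induction n using Nat.strong_induction_on generalizing w with
  | _ n ih =>
    have h := sum_ZExt_partialD_shiftCoeff n hw
    -- Induction, applied to the elements `shiftCoeff (n - i) w` of 𝔥⁰, removes all terms but i = n,
    -- where `shiftCoeff 0` is the identity.
    rwa [sum_range_succ, sum_eq_zero fun i hi => ih i (mem_range.1 hi) (shiftCoeff_mem_H0 _ hw),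
      zero_add, Nat.sub_self, shiftCoeff_zero_apply] at h

end Ohno

end MZV

end

theorem theorem1 (l : ℕ) (hl : 1 ≤ l) (w : MZV.H) (hw : w ∈ MZV.H0) :
    MZV.Z ⟨MZV.partialD l w, MZV.partialD_mem_H0 l hw⟩ = 0 := by
  obtain ⟨n, rfl⟩ : ∃ n, l = n + 1 := ⟨l - 1, by omega⟩
  exact MZV.ZExt_partialD n hw
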